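/- Write $\mathbf e_m(z)=e^{2\pi i z/m}$, let $\tau(n)$ be the number of positive divisors of $n$, and let $p$ always denote a prime. Let $\mathcal K$ be the set of all ordered pairs $\{\alpha,\beta\}$ of real numbers with $0\le\alpha,\beta\le 1$ for which there is a constant $C_{\alpha,\beta}$ such that $$\max_{(a,p)=1}\Big|\sum_{z=1}^{t}\mathbf e_p(a\theta^z)\Big|\le C_{\alpha,\beta}\,p^{\alpha}t^{\beta}$$ for every prime $p$ and every integer $\theta$ coprime to $p$, where $t$ denotes the multiplicative order of $\theta$ modulo $p$. Theorem. Let $\{\alpha,\beta\}\in\mathcal K$. Then there is a constant $C$, depending only on the pair $\{\alpha,\beta\}$, with the following property. Let $\lambda\ge 2$ be an integer, let $X>0$ and $\Delta>X^{1/3}$ be real numbers, and let $\mathcal E$ be the set of all primes $p\le X$ not dividing $\lambda$ such that the multiplicative order of $\lambda$ modulo $p$ is greater than $\Delta$. Then for any positive integer $N$, any real $L>0$ and any complex coefficients $\delta_n$, $1\le n\le N$, $$\sum_{p\in\mathcal{E}}\frac{1}{\tau(p-1)}\max_{(a,p)=1}\Big|\sum_{n=1}^N\delta_n \mathbf e_p(a\lambda^n)\Big|^2\le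 C\left(X\Big(X+NX^{\frac{2\alpha}{3-2\beta}}\Delta^{-\frac{2-2\beta}{3-2\beta}}L\Big)\sum_{n=1}^N|\delta_n|^2+XL^{-3+2\beta}\Big(\sum_{n=1}^N|\delta_n|\Big)^2\right).$$ -/

import Mathlib

/-- The additive character `e_m(z) = exp(2πiz/m)`, at integers `z`. -/
noncomputable def expMod (m : ℕ) (z : ℤ) : ℂ :=
  Complex.exp (2 * (Real.pi : ℂ) * Complex.I * (z : ℂ) / (m : ℂ))

/-- The set of admissible pairs `(α, β)`, `0 ≤ α, β ≤ 1`: there is a constant `C` (depending only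
on the pair) such that for every prime `p`, every integer `θ` prime to `p`, of multiplicative
order `t` modulo `p`, and every integer `a` prime to `p`, the sum of `e_p(a θ^z)` over
`1 ≤ z ≤ t` is at most `C p^α t^β` in absolute value. -/
def admissiblePairs : Set (ℝ × ℝ) :=
  {q | (0 ≤ q.1 ∧ q.1 ≤ 1) ∧ (0 ≤ q.2 ∧ q.2 ≤ 1) ∧
    ∃ C : ℝ, ∀ p : ℕ, p.Prime → ∀ θ : ℤ, IsCoprime θ (p : ℤ) →
      ∀ a : ℤ, IsCoprime a (p : ℤ) →
        ‖∑ z ∈ Finset.Icc 1 (orderOf (θ : ZMod p)), expMod p (a * θ ^ z)‖ ≤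
          C * (p : ℝ) ^ q.1 * (orderOf (θ : ZMod p) : ℝ) ^ q.2}

open Classical in
/-- The set `ℰ(Δ, X)` of the primes `p ≤ X` (not dividing `lam`) modulo which the multiplicative
order of `lam` exceeds `Δ`. -/
noncomputable def largeOrderPrimes (lam : ℕ) (Δ X : ℝ) : Finset ℕ :=
  (Finset.Icc 1 ⌊X⌋₊).filter
    (fun p => p.Prime ∧ ¬ p ∣ lam ∧ Δ < (orderOf (lam : ZMod p) : ℝ))

/-- The maximum over the integers `a` prime to `p` of `|∑_{n ≤ N} δ_n e_p(a lam^n)|^2`. The values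
are bounded (there are finitely many, by periodicity in `a`), so the supremum is a maximum. -/
noncomputable def maxSqExpSum (lam p N : ℕ) (δ : ℕ → ℂ) : ℝ :=
  ⨆ a : {a : ℤ // IsCoprime a (p : ℤ)},
    ‖∑ n ∈ Finset.Icc 1 N, δ n * expMod p (a.1 * (lam : ℤ) ^ n)‖ ^ 2

/-!
Let `t` be the order of `λ` modulo `p`, so that `f(n) = e_p(aλⁿ)` has period `t` and `t ∣ p - 1`.
Expanding `f` in the characters `n ↦ e(kn/t)` and writing each `k/t` in lowest terms as `c/d`,
`d ∣ t`, turns `∑ δ_n f(n)` into a sum of the values at `c/d` of `S(x) = ∑ δ_n e(nx)`, weighted by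
the Fourier coefficients of `f`. Cauchy's inequality over `d` costs a factor
`τ(t) ≤ τ(p - 1)`, which the weight in the theorem cancels. Cauchy's inequality over `c`, and
Parseval's identity for the Fourier coefficients, leave `((d/t) B_d)²` times
`T(d) = ∑_{(c,d)=1} |S(c/d)|²`, where `B_d` bounds the sums of `f` over one period of the
progressions of difference `d` (`norm_sum_mul_periodic_sq_le`). These are complete exponential sums
over the powers of `λ^d`, of order `t/d`; hence one may take `B_d = t/d`, or
`B_d = K p^α (t/d)^β` when `(α, β)` is admissible.

At most `X/d` primes `p ≤ X` satisfy `d ∣ p - 1`, so after summation over `p` the quantity `T(d)`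
carries the weight `X/d`. With `R = X^{2α/(3-2β)} Δ^{-(2-2β)/(3-2β)} L`, the divisors `d ≥ 1/R` are
treated with the trivial `B_d` and the large sieve inequality
`∑_{d ≤ Q} T(d) ≪ (Q² + N) ∑ |δ_n|²` with partial summation (`sum_large_denominators_le`).
The divisors `d < 1/R` are treated with the second `B_d` and the trivial bound
`T(d) ≤ d (∑ |δ_n|)²` (`sum_small_denominators_le`).

The large sieve inequality (`sum_fareySum_le`) is proved by Gallagher's method: `|S|²` at a point is
compared with its integral over a short interval about it, and the intervals about the Farey
fractions of order `Q` are disjoint.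
-/

/-! ### The large sieve inequality -/

/-- The additive character `e(x) = exp(2πix)` of `ℝ`. -/
noncomputable def unitExp (x : ℝ) : ℂ := Complex.exp (2 * (Real.pi : ℂ) * Complex.I * (x : ℂ))

lemma unitExp_add (x y : ℝ) : unitExp (x + y) = unitExp x * unitExp y := by
  simp only [unitExp, ← Complex.exp_add]
  congr 1
  push_cast
  ring

lemma norm_unitExp (x : ℝ) : ‖unitExp x‖ = 1 := by
  have : unitExp x = Complex.exp (((2 * Real.pi * x : ℝ) : ℂ) * Complex.I) := by
    rw [unitExp]; congr 1; push_cast; ring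
  rw [this, Complex.norm_exp_ofReal_mul_I]

lemma conj_unitExp (x : ℝ) : (starRingEnd ℂ) (unitExp x) = unitExp (-x) := by
  rw [unitExp, unitExp, ← Complex.exp_conj]
  congr 1
  simp only [map_mul, Complex.conj_ofReal, Complex.conj_I, map_ofNat, Complex.ofReal_neg]
  ring

lemma unitExp_eq_one_iff (x : ℝ) : unitExp x = 1 ↔ ∃ k : ℤ, x = k := by
  rw [unitExp, Complex.exp_eq_one_iff]
  refine exists_congr fun k => ?_
  have h : 2 * (Real.pi : ℂ) * Complex.I ≠ 0 := Complex.two_pi_I_ne_zero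
  constructor
  · intro hk
    have : (x : ℂ) = (k : ℂ) := mul_left_cancel₀ h (by rw [hk]; ring)
    exact_mod_cast this
  · rintro rfl
    push_cast
    ring

lemma hasDerivAt_unitExp_mul (c x : ℝ) :
    HasDerivAt (fun y : ℝ => unitExp (c * y))
      (2 * (Real.pi : ℂ) * Complex.I * (c : ℂ) * unitExp (c * x)) x := by
  have h : HasDerivAt (fun y : ℝ => 2 * (Real.pi : ℂ) * Complex.I * ((c * y : ℝ) : ℂ))
      (2 * (Real.pi : ℂ) * Complex.I * (c : ℂ)) x := by
    have h1 : HasDerivAt (fun y : ℝ => ((c * y : ℝ) : ℂ)) (c : ℂ) x := by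
      have h2 : HasDerivAt (fun y : ℝ => c * y) c x := by
        simpa using (hasDerivAt_id x).const_mul c
      exact h2.ofReal_comp
    exact h1.const_mul _
  have := h.cexp
  rwa [mul_comm (Complex.exp _)] at this

/-- The exponential polynomial `S(x) = ∑_{n ≤ N} δ_n e(nx)`. -/
noncomputable def trigSum (δ : ℕ → ℂ) (N : ℕ) (x : ℝ) : ℂ :=
  ∑ n ∈ Finset.Icc 1 N, δ n * unitExp (n * x)

lemma hasDerivAt_trigSum (δ : ℕ → ℂ) (N : ℕ) (x : ℝ) :
    HasDerivAt (trigSum δ N)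
      (trigSum (fun n => 2 * (Real.pi : ℂ) * Complex.I * (n : ℂ) * δ n) N x) x := by
  unfold trigSum
  apply HasDerivAt.fun_sum
  intro n _
  have := (hasDerivAt_unitExp_mul n x).const_mul (δ n)
  refine this.congr_deriv ?_
  rw [Complex.ofReal_natCast]
  ring

lemma continuous_trigSum (δ : ℕ → ℂ) (N : ℕ) : Continuous (trigSum δ N) :=
  continuous_iff_continuousAt.2 fun x => (hasDerivAt_trigSum δ N x).continuousAt

lemma norm_trigSum_le (δ : ℕ → ℂ) (N : ℕ) (x : ℝ) :
    ‖trigSum δ N x‖ ≤ ∑ n ∈ Finset.Icc 1 N, ‖δ n‖ := by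
  refine (norm_sum_le _ _).trans (Finset.sum_le_sum fun n _ => ?_)
  rw [norm_mul, norm_unitExp, mul_one]

lemma integral_unitExp_int_mul {k : ℤ} (hk : k ≠ 0) (c : ℝ) :
    ∫ x in c..(c + 1), unitExp (k * x) = 0 := by
  have hne : 2 * (Real.pi : ℂ) * Complex.I * (((k : ℝ)) : ℂ) ≠ 0 :=
    mul_ne_zero Complex.two_pi_I_ne_zero (by exact_mod_cast hk)
  have hd : ∀ x ∈ Set.uIcc c (c + 1), HasDerivAt
      (fun y : ℝ => (2 * (Real.pi : ℂ) * Complex.I * (((k : ℝ)) : ℂ))⁻¹ * unitExp (k * y))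
      (unitExp (k * x)) x := by
    intro x _
    have := (hasDerivAt_unitExp_mul k x).const_mul
      (2 * (Real.pi : ℂ) * Complex.I * (((k : ℝ)) : ℂ))⁻¹
    rwa [inv_mul_cancel_left₀ hne] at this
  have hc : Continuous fun x : ℝ => unitExp (k * x) :=
    continuous_iff_continuousAt.2 fun x => (hasDerivAt_unitExp_mul k x).continuousAt
  rw [intervalIntegral.integral_eq_sub_of_hasDerivAt hd (hc.intervalIntegrable _ _), mul_add,
    unitExp_add, mul_one, (unitExp_eq_one_iff (k : ℝ)).2 ⟨k, rfl⟩, mul_one, sub_self]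

/-- Parseval's identity for exponential polynomials. -/
lemma integral_norm_trigSum_sq (δ : ℕ → ℂ) (N : ℕ) (c : ℝ) :
    ∫ x in c..(c + 1), ‖trigSum δ N x‖ ^ 2 = ∑ n ∈ Finset.Icc 1 N, ‖δ n‖ ^ 2 := by
  have hpt : ∀ x : ℝ, ((‖trigSum δ N x‖ ^ 2 : ℝ) : ℂ) = ∑ n ∈ Finset.Icc 1 N,
      ∑ m ∈ Finset.Icc 1 N, δ n * (starRingEnd ℂ) (δ m) *
        unitExp ((((n : ℤ) - (m : ℤ) : ℤ) : ℝ) * x) := by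
    intro x
    rw [← Complex.normSq_eq_norm_sq, ← Complex.mul_conj, trigSum, map_sum, Finset.sum_mul_sum]
    refine Finset.sum_congr rfl fun n _ => Finset.sum_congr rfl fun m _ => ?_
    rw [map_mul, conj_unitExp]
    have : ((((n : ℤ) - (m : ℤ) : ℤ) : ℝ) * x) = n * x + -(m * x) := by push_cast; ring
    rw [this, unitExp_add]
    ring
  have hc : ∀ k : ℤ, Continuous fun x : ℝ => unitExp (k * x) := fun k =>
    continuous_iff_continuousAt.2 fun x => (hasDerivAt_unitExp_mul k x).continuousAt
  have hterm : ∀ n m : ℕ, ∫ x in c..(c + 1), δ n * (starRingEnd ℂ) (δ m) *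
        unitExp ((((n : ℤ) - (m : ℤ) : ℤ) : ℝ) * x) =
      if n = m then ((‖δ n‖ ^ 2 : ℝ) : ℂ) else 0 := by
    intro n m
    rw [intervalIntegral.integral_const_mul]
    split_ifs with h
    · subst h
      have h1 : unitExp 0 = 1 := (unitExp_eq_one_iff 0).2 ⟨0, by simp⟩
      simp only [sub_self, Int.cast_zero, zero_mul, h1]
      rw [← Complex.normSq_eq_norm_sq, ← Complex.mul_conj]
      simp
    · rw [integral_unitExp_int_mul (by omega), mul_zero]
  have hC : ((∫ x in c..(c + 1), ‖trigSum δ N x‖ ^ 2 : ℝ) : ℂ) =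
      ((∑ n ∈ Finset.Icc 1 N, ‖δ n‖ ^ 2 : ℝ) : ℂ) := by
    rw [← intervalIntegral.integral_ofReal]
    simp only [hpt]
    have hcm : ∀ n m : ℕ, Continuous fun x : ℝ => δ n * (starRingEnd ℂ) (δ m) *
        unitExp ((((n : ℤ) - (m : ℤ) : ℤ) : ℝ) * x) := fun n m => continuous_const.mul (hc _)
    rw [intervalIntegral.integral_finsetSum fun n _ => Continuous.intervalIntegrable
      (continuous_finsetSum _ fun m _ => hcm n m) _ _]
    rw [Complex.ofReal_sum]
    refine Finset.sum_congr rfl fun n hn => ?_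
    rw [intervalIntegral.integral_finsetSum fun m _ => (hcm n m).intervalIntegrable _ _]
    simp only [hterm]
    rw [Finset.sum_ite_eq, if_pos hn]
  exact_mod_cast hC

/-- Gallagher's inequality: a value of `g` is at most its mean over an interval centred there, plus
the total variation of `g` on that interval. -/
lemma mul_le_integral_add_integral_abs_deriv {g g' : ℝ → ℝ} (hg : ∀ x, HasDerivAt g (g' x) x)
    (hg' : Continuous g') {η : ℝ} (hη : 0 < η) (x : ℝ) :
    η * g x ≤ (∫ y in (x - η / 2)..(x + η / 2), g y) +
      η * ∫ y in (x - η / 2)..(x + η / 2), |g' y| := by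
  have hgc : Continuous g := continuous_iff_continuousAt.2 fun x => (hg x).continuousAt
  set K := ∫ y in (x - η / 2)..(x + η / 2), |g' y| with hK
  have hle : x - η / 2 ≤ x + η / 2 := by linarith
  have hpt : ∀ y ∈ Set.Icc (x - η / 2) (x + η / 2), g x ≤ g y + K := by
    intro y hy
    have h1 : ∫ z in y..x, g' z = g x - g y :=
      intervalIntegral.integral_eq_sub_of_hasDerivAt (fun z _ => hg z)
        (hg'.intervalIntegrable _ _)
    have h2 : |∫ z in y..x, g' z| ≤ abs (∫ z in y..x, |g' z|) :=
      intervalIntegral.norm_integral_le_abs_integral_norm (f := g')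
    have h3 : abs (∫ z in y..x, |g' z|) ≤ abs (∫ z in (x - η / 2)..(x + η / 2), |g' z|) := by
      apply intervalIntegral.abs_integral_mono_interval
      · rw [Set.uIoc_of_le hle]
        rcases le_total y x with h | h
        · rw [Set.uIoc_of_le h]
          exact Set.Ioc_subset_Ioc hy.1 (by linarith)
        · rw [Set.uIoc_of_ge h]
          exact Set.Ioc_subset_Ioc (by linarith) hy.2
      · exact Filter.Eventually.of_forall fun z => abs_nonneg _
      · exact hg'.abs.intervalIntegrable _ _
    have h4 : 0 ≤ K := intervalIntegral.integral_nonneg hle fun z _ => abs_nonneg _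
    rw [← hK, abs_of_nonneg h4] at h3
    have := le_abs_self (∫ z in y..x, g' z)
    linarith
  have hgK : Continuous fun y => g y + K := hgc.add continuous_const
  have hint := intervalIntegral.integral_mono_on hle
    (intervalIntegrable_const (μ := MeasureTheory.volume) (c := g x))
    (hgK.intervalIntegrable _ _) hpt
  rw [intervalIntegral.integral_add (hgc.intervalIntegrable _ _) intervalIntegrable_const] at hint
  simp only [intervalIntegral.integral_const, smul_eq_mul] at hint
  have : x + η / 2 - (x - η / 2) = η := by ring
  rwa [this] at hint

/-- Intervals of length `η` about `η`-spaced points of `[η, 1]` are disjoint and lie in an interval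
of length `1`. -/
lemma sum_integral_le_of_spaced {ι : Type*} (s : Finset ι) (x : ι → ℝ) {η : ℝ} (hη : 0 < η)
    (hx : ∀ i ∈ s, η ≤ x i ∧ x i ≤ 1) (hsp : ∀ i ∈ s, ∀ j ∈ s, i ≠ j → η ≤ |x i - x j|)
    {g : ℝ → ℝ} (hg : Continuous g) (hg0 : ∀ y, 0 ≤ g y) :
    ∑ i ∈ s, ∫ y in (x i - η / 2)..(x i + η / 2), g y ≤
      ∫ y in (η / 2)..(η / 2 + 1), g y := by
  have h1 : ∀ i ∈ s, ∫ y in (x i - η / 2)..(x i + η / 2), g y =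
      ∫ y in Set.Ioc (x i - η / 2) (x i + η / 2), g y := fun i _ =>
    intervalIntegral.integral_of_le (by linarith)
  have hio : ∀ a b : ℝ, MeasureTheory.IntegrableOn g (Set.Ioc a b) := fun a b =>
    (hg.integrableOn_Icc (a := a) (b := b)).mono_set Set.Ioc_subset_Icc_self
  rw [Finset.sum_congr rfl h1, intervalIntegral.integral_of_le (by linarith),
    ← MeasureTheory.integral_biUnion_finset s (fun _ _ => measurableSet_Ioc) ?_
      (fun i _ => hio _ _)]
  · refine MeasureTheory.setIntegral_mono_set (hio _ _)
      (Filter.Eventually.of_forall fun y => hg0 y) (LE.le.eventuallyLE ?_)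
    refine Set.iUnion₂_subset fun i hi => Set.Ioc_subset_Ioc ?_ ?_
    · linarith [(hx i hi).1]
    · linarith [(hx i hi).2]
  · intro i hi j hj hij
    refine Set.disjoint_left.2 fun y hy hy' => ?_
    have h := hsp i hi j hj hij
    rcases le_abs.1 h with h | h
    · linarith [hy.1, hy'.2]
    · linarith [hy.2, hy'.1]

/-- The large sieve inequality for `η`-spaced points of `[η, 1]`. -/
lemma sum_norm_trigSum_sq_le_of_spaced {ι : Type*} (s : Finset ι) (x : ι → ℝ) {η : ℝ} (hη : 0 < η)
    (hx : ∀ i ∈ s, η ≤ x i ∧ x i ≤ 1) (hsp : ∀ i ∈ s, ∀ j ∈ s, i ≠ j → η ≤ |x i - x j|)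
    (δ : ℕ → ℂ) (N : ℕ) :
    ∑ i ∈ s, ‖trigSum δ N (x i)‖ ^ 2 ≤
      (η⁻¹ + (1 + 4 * Real.pi ^ 2) * N) * ∑ n ∈ Finset.Icc 1 N, ‖δ n‖ ^ 2 := by
  rcases Nat.eq_zero_or_pos N with rfl | hN
  · simp [trigSum]
  have hN' : (0 : ℝ) < N := by exact_mod_cast hN
  set E := ∑ n ∈ Finset.Icc 1 N, ‖δ n‖ ^ 2 with hE
  set δ' : ℕ → ℂ := fun n => 2 * (Real.pi : ℂ) * Complex.I * (n : ℂ) * δ n with hδ'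
  have hS := continuous_trigSum δ N
  have hS' := continuous_trigSum δ' N
  have hd : ∀ y, HasDerivAt (fun y => ‖trigSum δ N y‖ ^ 2)
      (2 * inner ℝ (trigSum δ N y) (trigSum δ' N y)) y := fun y =>
    (hasDerivAt_trigSum δ N y).norm_sq
  have hdc : Continuous fun y => 2 * inner ℝ (trigSum δ N y) (trigSum δ' N y) :=
    continuous_const.mul (hS.inner hS')
  have hE' : ∑ n ∈ Finset.Icc 1 N, ‖δ' n‖ ^ 2 ≤ 4 * Real.pi ^ 2 * N ^ 2 * E := by
    rw [hE, Finset.mul_sum]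
    refine Finset.sum_le_sum fun n hn => ?_
    have hn' : (n : ℝ) ≤ N := by exact_mod_cast (Finset.mem_Icc.1 hn).2
    have : ‖δ' n‖ ^ 2 = 4 * Real.pi ^ 2 * (n : ℝ) ^ 2 * ‖δ n‖ ^ 2 := by
      simp only [hδ', norm_mul, Complex.norm_ofNat, Complex.norm_real, Complex.norm_I,
        Complex.norm_natCast, Real.norm_eq_abs, mul_pow, sq_abs]
      ring
    rw [this]
    gcongr
  -- The weight `N` balances the two terms of the arithmetic-geometric mean inequality.
  have habs : ∀ y, |2 * inner ℝ (trigSum δ N y) (trigSum δ' N y)| ≤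
      N * ‖trigSum δ N y‖ ^ 2 + (N : ℝ)⁻¹ * ‖trigSum δ' N y‖ ^ 2 := by
    intro y
    rw [abs_mul, abs_two]
    have h1 := abs_real_inner_le_norm (trigSum δ N y) (trigSum δ' N y)
    have h2 : 2 * (‖trigSum δ N y‖ * ‖trigSum δ' N y‖) ≤
        N * ‖trigSum δ N y‖ ^ 2 + (N : ℝ)⁻¹ * ‖trigSum δ' N y‖ ^ 2 := by
      have h3 : (0 : ℝ) ≤ (N : ℝ)⁻¹ * (N * ‖trigSum δ N y‖ - ‖trigSum δ' N y‖) ^ 2 := by positivity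
      have h4 : (N : ℝ)⁻¹ * (N * ‖trigSum δ N y‖ - ‖trigSum δ' N y‖) ^ 2 =
          N * ‖trigSum δ N y‖ ^ 2 + (N : ℝ)⁻¹ * ‖trigSum δ' N y‖ ^ 2 -
            2 * (‖trigSum δ N y‖ * ‖trigSum δ' N y‖) := by
        field_simp
        ring
      linarith
    linarith
  have hpars : ∫ y in (η / 2)..(η / 2 + 1), ‖trigSum δ N y‖ ^ 2 = E :=
    integral_norm_trigSum_sq δ N _
  have hvar : ∫ y in (η / 2)..(η / 2 + 1), |2 * inner ℝ (trigSum δ N y) (trigSum δ' N y)| ≤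
      (1 + 4 * Real.pi ^ 2) * N * E := by
    have hc1 : Continuous fun y => (N : ℝ) * ‖trigSum δ N y‖ ^ 2 :=
      continuous_const.mul (hS.norm.pow 2)
    have hc2 : Continuous fun y => (N : ℝ)⁻¹ * ‖trigSum δ' N y‖ ^ 2 :=
      continuous_const.mul (hS'.norm.pow 2)
    have hc12 : Continuous fun y => (N : ℝ) * ‖trigSum δ N y‖ ^ 2 +
        (N : ℝ)⁻¹ * ‖trigSum δ' N y‖ ^ 2 := hc1.add hc2
    have h1 := intervalIntegral.integral_mono_on (a := η / 2) (b := η / 2 + 1) (by linarith)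
      (hdc.abs.intervalIntegrable _ _) (hc12.intervalIntegrable _ _ (μ := MeasureTheory.volume))
      (fun y _ => habs y)
    rw [intervalIntegral.integral_add (hc1.intervalIntegrable _ _) (hc2.intervalIntegrable _ _),
      intervalIntegral.integral_const_mul, intervalIntegral.integral_const_mul, hpars,
      integral_norm_trigSum_sq δ' N] at h1
    have h2 : (N : ℝ)⁻¹ * ∑ n ∈ Finset.Icc 1 N, ‖δ' n‖ ^ 2 ≤
        (N : ℝ)⁻¹ * (4 * Real.pi ^ 2 * N ^ 2 * E) := by gcongr
    have h3 : (N : ℝ)⁻¹ * (4 * Real.pi ^ 2 * N ^ 2 * E) = 4 * Real.pi ^ 2 * N * E := by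
      field_simp
    linarith
  have hmain : η * ∑ i ∈ s, ‖trigSum δ N (x i)‖ ^ 2 ≤
      E + η * ((1 + 4 * Real.pi ^ 2) * N * E) := by
    calc η * ∑ i ∈ s, ‖trigSum δ N (x i)‖ ^ 2
        ≤ ∑ i ∈ s, ((∫ y in (x i - η / 2)..(x i + η / 2), ‖trigSum δ N y‖ ^ 2) +
            η * ∫ y in (x i - η / 2)..(x i + η / 2),
              |2 * inner ℝ (trigSum δ N y) (trigSum δ' N y)|) := by
          rw [Finset.mul_sum]
          exact Finset.sum_le_sum fun i _ =>
            mul_le_integral_add_integral_abs_deriv hd hdc hη (x i)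
      _ ≤ E + η * ((1 + 4 * Real.pi ^ 2) * N * E) := by
          rw [Finset.sum_add_distrib, ← Finset.mul_sum]
          gcongr
          · exact (sum_integral_le_of_spaced s x hη hx hsp (hS.norm.pow 2)
              fun y => sq_nonneg _).trans hpars.le
          · exact (sum_integral_le_of_spaced s x hη hx hsp hdc.abs
              fun y => abs_nonneg _).trans hvar
  rw [← sub_nonneg] at hmain ⊢
  have : (η⁻¹ + (1 + 4 * Real.pi ^ 2) * N) * E - ∑ i ∈ s, ‖trigSum δ N (x i)‖ ^ 2 =
      η⁻¹ * (E + η * ((1 + 4 * Real.pi ^ 2) * N * E) -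
        η * ∑ i ∈ s, ‖trigSum δ N (x i)‖ ^ 2) := by
    field_simp
  rw [this]
  exact mul_nonneg (inv_nonneg.2 hη.le) hmain

/-- The sum of `|S(c/d)|²` over the reduced fractions `c/d ∈ (0, 1]` of denominator `d`. -/
noncomputable def fareySum (δ : ℕ → ℂ) (N d : ℕ) : ℝ :=
  ∑ c ∈ (Finset.Icc 1 d).filter (fun c => c.Coprime d), ‖trigSum δ N ((c : ℝ) / d)‖ ^ 2

lemma fareySum_nonneg (δ : ℕ → ℂ) (N d : ℕ) : 0 ≤ fareySum δ N d :=
  Finset.sum_nonneg fun _ _ => by positivity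

lemma fareySum_le (δ : ℕ → ℂ) (N d : ℕ) :
    fareySum δ N d ≤ d * (∑ n ∈ Finset.Icc 1 N, ‖δ n‖) ^ 2 := by
  calc fareySum δ N d
      ≤ ∑ c ∈ (Finset.Icc 1 d).filter (fun c => c.Coprime d),
          (∑ n ∈ Finset.Icc 1 N, ‖δ n‖) ^ 2 := by
        refine Finset.sum_le_sum fun c _ => ?_
        gcongr
        exact norm_trigSum_le δ N _
    _ ≤ d * (∑ n ∈ Finset.Icc 1 N, ‖δ n‖) ^ 2 := by
        rw [Finset.sum_const, nsmul_eq_mul]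
        gcongr
        exact_mod_cast (Finset.card_filter_le _ _).trans (by simp)

/-- The classical large sieve inequality, over the Farey fractions of order `Q`. -/
lemma sum_fareySum_le (δ : ℕ → ℂ) (N Q : ℕ) :
    ∑ d ∈ Finset.Icc 1 Q, fareySum δ N d ≤
      ((Q : ℝ) ^ 2 + (1 + 4 * Real.pi ^ 2) * N) * ∑ n ∈ Finset.Icc 1 N, ‖δ n‖ ^ 2 := by
  rcases Nat.eq_zero_or_pos Q with rfl | hQ
  · have : 0 ≤ ∑ n ∈ Finset.Icc 1 N, ‖δ n‖ ^ 2 := Finset.sum_nonneg fun _ _ => by positivity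
    simp only [Finset.Icc_eq_empty_of_lt one_pos, Finset.sum_empty]
    exact mul_nonneg (by positivity) this
  have hQ' : (1 : ℝ) ≤ Q := by exact_mod_cast hQ
  unfold fareySum
  rw [Finset.sum_sigma']
  have key := sum_norm_trigSum_sq_le_of_spaced
    ((Finset.Icc 1 Q).sigma fun d => (Finset.Icc 1 d).filter (fun c => c.Coprime d))
    (fun i => (i.2 : ℝ) / i.1) (η := ((Q : ℝ) ^ 2)⁻¹) (by positivity) ?_ ?_ δ N
  · rwa [inv_inv] at key
  · rintro ⟨d, c⟩ h
    simp only [Finset.mem_sigma, Finset.mem_Icc, Finset.mem_filter] at h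
    obtain ⟨⟨hd1, hdQ⟩, ⟨hc1, hcd⟩, -⟩ := h
    have hd1' : (1 : ℝ) ≤ d := by exact_mod_cast hd1
    have hdQ' : (d : ℝ) ≤ Q := by exact_mod_cast hdQ
    have hc1' : (1 : ℝ) ≤ c := by exact_mod_cast hc1
    have hcd' : (c : ℝ) ≤ d := by exact_mod_cast hcd
    refine ⟨?_, (div_le_one (by linarith)).2 hcd'⟩
    show ((Q : ℝ) ^ 2)⁻¹ ≤ (c : ℝ) / d
    rw [le_div_iff₀ (by linarith), inv_mul_le_iff₀ (by positivity)]
    nlinarith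
  · rintro ⟨d, c⟩ h ⟨d', c'⟩ h' hne
    simp only [Finset.mem_sigma, Finset.mem_Icc, Finset.mem_filter] at h h'
    obtain ⟨⟨hd1, hdQ⟩, -, hco⟩ := h
    obtain ⟨⟨hd1', hdQ'⟩, -, hco'⟩ := h'
    have hdpos : (0 : ℝ) < d := by exact_mod_cast hd1
    have hdpos' : (0 : ℝ) < d' := by exact_mod_cast hd1'
    have hnum : (c : ℤ) * d' - d * c' ≠ 0 := by
      intro h0
      have h1 : c * d' = d * c' := by
        have : (c : ℤ) * d' = d * c' := by linarith
        exact_mod_cast this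
      have hdd : d ∣ d' := hco.symm.dvd_of_dvd_mul_left ⟨c', h1⟩
      have hdd' : d' ∣ d := hco'.symm.dvd_of_dvd_mul_right ⟨c, by rw [← h1, mul_comm]⟩
      obtain rfl := Nat.dvd_antisymm hdd hdd'
      have : c = c' := Nat.eq_of_mul_eq_mul_right hd1 (by rw [h1, mul_comm])
      exact hne (by rw [this])
    have habs : (1 : ℝ) ≤ |(c : ℝ) * d' - d * c'| := by
      exact_mod_cast Int.one_le_abs hnum
    show ((Q : ℝ) ^ 2)⁻¹ ≤ |(c : ℝ) / d - (c' : ℝ) / d'|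
    rw [div_sub_div _ _ hdpos.ne' hdpos'.ne', abs_div, abs_of_pos (mul_pos hdpos hdpos'),
      le_div_iff₀ (mul_pos hdpos hdpos'), inv_mul_le_iff₀ (by positivity)]
    have h1 : (d : ℝ) * d' ≤ Q * Q := by
      exact_mod_cast Nat.mul_le_mul hdQ hdQ'
    nlinarith

/-- Partial summation of the large sieve inequality, with the weight `1 / d`. -/
lemma sum_fareySum_div_le (δ : ℕ → ℂ) (N : ℕ) {q M : ℕ} (hq : 1 ≤ q) (hqM : q ≤ M) :
    ∑ d ∈ Finset.Icc q M, fareySum δ N d / d ≤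
      (2 * M + (1 + 4 * Real.pi ^ 2) * N / q) * ∑ n ∈ Finset.Icc 1 N, ‖δ n‖ ^ 2 := by
  set E := ∑ n ∈ Finset.Icc 1 N, ‖δ n‖ ^ 2 with hE
  set κ : ℝ := (1 + 4 * Real.pi ^ 2) * N with hκ
  have hE0 : 0 ≤ E := Finset.sum_nonneg fun _ _ => by positivity
  have hκ0 : 0 ≤ κ := by positivity
  set F : ℕ → ℝ := fun Q => ∑ d ∈ Finset.Icc q Q, fareySum δ N d with hF
  have hFle : ∀ Q, F Q ≤ ((Q : ℝ) ^ 2 + κ) * E := fun Q =>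
    (Finset.sum_le_sum_of_subset_of_nonneg (Finset.Icc_subset_Icc_left hq)
      fun d _ _ => fareySum_nonneg δ N d).trans (sum_fareySum_le δ N Q)
  have hq0 : (1 : ℝ) ≤ q := by exact_mod_cast hq
  have hstep : ∀ M, q ≤ M → ∑ d ∈ Finset.Icc q M, fareySum δ N d / d ≤
      F M / M + (M - q + κ * (1 / q - 1 / M)) * E := by
    intro M hM
    induction M, hM using Nat.le_induction with
    | base => simp [hF]
    | succ M hM ih =>
      have hM0 : (1 : ℝ) ≤ M := by exact_mod_cast hq.trans hM
      have hFs : F (M + 1) = F M + fareySum δ N (M + 1) := by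
        simp only [hF]
        rw [Finset.sum_Icc_succ_top (by omega)]
      rw [Finset.sum_Icc_succ_top (by omega), hFs]
      push_cast
      have h1 : F M / M - F M / (M + 1) ≤ (1 + κ * (1 / M - 1 / (M + 1))) * E := by
        have h2 : F M / M - F M / (M + 1) = F M * (1 / (M * (M + 1))) := by
          field_simp; ring
        have h3 : F M * (1 / (M * (M + 1))) ≤ (((M : ℝ) ^ 2 + κ) * E) * (1 / (M * (M + 1))) := by
          gcongr
          exact hFle M
        have h4 : (((M : ℝ) ^ 2 + κ) * E) * (1 / (M * (M + 1))) =
            ((M : ℝ) / (M + 1) + κ * (1 / M - 1 / (M + 1))) * E := by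
          field_simp; ring
        have h5 : (M : ℝ) / (M + 1) ≤ 1 := by
          rw [div_le_one (by linarith)]; linarith
        rw [h2]
        refine h3.trans (h4.trans_le ?_)
        gcongr
      rw [add_div]
      nlinarith
  have hM0 : (1 : ℝ) ≤ M := by exact_mod_cast hq.trans hqM
  refine (hstep M hqM).trans ?_
  have h1 : F M / M ≤ ((M : ℝ) + κ * (1 / M)) * E := by
    rw [div_le_iff₀ (by linarith)]
    refine (hFle M).trans (le_of_eq ?_)
    field_simp
  have h2 : (2 * (M : ℝ) + κ / q) * E =
      ((M : ℝ) + κ * (1 / M)) * E + (M - q + κ * (1 / q - 1 / M)) * E + q * E := by ring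
  have h3 : 0 ≤ q * E := by positivity
  linarith

/-! ### Finite Fourier expansion of a periodic sequence -/

lemma unitExp_nat_mul (n : ℕ) (x : ℝ) : unitExp (n * x) = unitExp x ^ n := by
  rw [unitExp, unitExp, ← Complex.exp_nat_mul]
  congr 1
  push_cast
  ring

lemma sum_unitExp_eq {t : ℕ} (ht : 0 < t) (m : ℤ) :
    ∑ k ∈ Finset.Icc 1 t, unitExp ((k : ℝ) / t * m) = if (t : ℤ) ∣ m then (t : ℂ) else 0 := by
  have ht' : (t : ℝ) ≠ 0 := by exact_mod_cast ht.ne'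
  have hk : ∀ k : ℕ, unitExp ((k : ℝ) / t * m) = unitExp (m / t) ^ k := by
    intro k
    rw [← unitExp_nat_mul]
    congr 1
    ring
  simp only [hk]
  have h1 : unitExp (m / t) = 1 ↔ (t : ℤ) ∣ m := by
    rw [unitExp_eq_one_iff]
    refine exists_congr fun k => ?_
    rw [div_eq_iff ht', mul_comm]
    exact_mod_cast Iff.rfl
  split_ifs with h
  · rw [h1.2 h]
    simp
  · have hne : unitExp (m / t) - 1 ≠ 0 := sub_ne_zero.2 fun h' => h (h1.1 h')
    have hpow : unitExp (m / t) ^ t = 1 := by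
      rw [← unitExp_nat_mul, mul_div_cancel₀ _ ht']
      exact (unitExp_eq_one_iff _).2 ⟨m, rfl⟩
    have hgeom : ∑ k ∈ Finset.range t, unitExp (m / t) ^ k = 0 := by
      have := geom_sum_mul (unitExp (m / t)) t
      rw [hpow, sub_self] at this
      exact (mul_eq_zero.1 this).resolve_right hne
    rw [← Finset.Ico_add_one_right_eq_Icc, Finset.sum_Ico_eq_sum_range]
    simp only [pow_add, add_tsub_cancel_right, ← Finset.mul_sum, hgeom, mul_zero]

/-- The Fourier transform `∑_{z < t} f(z) e(-xz)` of one period of `f`. -/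
noncomputable def periodTransform (f : ℕ → ℂ) (t : ℕ) (x : ℝ) : ℂ :=
  ∑ z ∈ Finset.range t, f z * unitExp (-(x * z))

lemma sum_periodTransform_mul {f : ℕ → ℂ} {t : ℕ} (ht : 0 < t)
    (hf : ∀ n, f (n + t) = f n) (n : ℕ) :
    ∑ k ∈ Finset.Icc 1 t, periodTransform f t ((k : ℝ) / t) * unitExp (n * ((k : ℝ) / t)) =
      t * f n := by
  have h1 : ∀ k : ℕ, periodTransform f t ((k : ℝ) / t) * unitExp (n * ((k : ℝ) / t)) =
      ∑ z ∈ Finset.range t, f z * unitExp ((k : ℝ) / t * ((n - z : ℤ) : ℝ)) := by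
    intro k
    rw [periodTransform, Finset.sum_mul]
    refine Finset.sum_congr rfl fun z _ => ?_
    rw [mul_assoc, ← unitExp_add]
    congr 2
    push_cast
    ring
  simp only [h1]
  rw [Finset.sum_comm]
  simp only [← Finset.mul_sum, sum_unitExp_eq ht]
  rw [Finset.sum_eq_single_of_mem (n % t) (Finset.mem_range.2 (Nat.mod_lt _ ht))]
  · have hd : (t : ℤ) ∣ (n : ℤ) - (n % t : ℕ) := by
      rw [Int.natCast_mod]
      exact Int.dvd_self_sub_emod
    rw [if_pos hd, mul_comm, Function.Periodic.map_mod_nat hf]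
  · intro z hz hne
    rw [if_neg, mul_zero]
    intro hd
    apply hne
    have h2 : z ≡ n [MOD t] := Nat.modEq_iff_dvd.2 hd
    rw [← h2, Nat.mod_eq_of_lt (Finset.mem_range.1 hz)]

/-- Every fraction `k/t ∈ (0, 1]` is, in lowest terms, `c/d` for a unique divisor `d` of `t`. -/
lemma sum_div_eq_sum_divisors (H : ℝ → ℂ) {t : ℕ} (ht : 0 < t) :
    ∑ k ∈ Finset.Icc 1 t, H ((k : ℝ) / t) =
      ∑ d ∈ t.divisors, ∑ c ∈ (Finset.Icc 1 d).filter (fun c => c.Coprime d), H ((c : ℝ) / d) := by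
  rw [Finset.sum_sigma']
  symm
  refine Finset.sum_bij' (fun i _ => i.2 * (t / i.1))
    (fun k _ => ⟨t / k.gcd t, k / k.gcd t⟩) ?_ ?_ ?_ ?_ ?_
  · rintro ⟨d, c⟩ h
    simp only [Finset.mem_sigma, Nat.mem_divisors, Finset.mem_Icc, Finset.mem_filter] at h ⊢
    obtain ⟨⟨hd, -⟩, ⟨hc1, hcd⟩, -⟩ := h
    have h1 : 0 < t / d := Nat.div_pos (Nat.le_of_dvd ht hd) (Nat.pos_of_dvd_of_pos hd ht)
    refine ⟨Nat.mul_pos hc1 h1, ?_⟩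
    calc c * (t / d) ≤ d * (t / d) := Nat.mul_le_mul_right _ hcd
      _ = t := Nat.mul_div_cancel' hd
  · intro k h
    simp only [Finset.mem_sigma, Nat.mem_divisors, Finset.mem_Icc, Finset.mem_filter] at h ⊢
    have hg : 0 < k.gcd t := Nat.gcd_pos_of_pos_right _ ht
    exact ⟨⟨Nat.div_dvd_of_dvd (Nat.gcd_dvd_right _ _), ht.ne'⟩,
      ⟨Nat.div_pos (Nat.le_of_dvd h.1 (Nat.gcd_dvd_left _ _)) hg, Nat.div_le_div_right h.2⟩,
      Nat.coprime_div_gcd_div_gcd hg⟩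
  · rintro ⟨d, c⟩ h
    simp only [Finset.mem_sigma, Nat.mem_divisors, Finset.mem_Icc, Finset.mem_filter] at h
    obtain ⟨⟨hd, -⟩, ⟨hc1, hcd⟩, hco⟩ := h
    have hdpos : 0 < d := Nat.pos_of_dvd_of_pos hd ht
    obtain ⟨m, rfl⟩ := hd
    have hm : 0 < m := Nat.pos_of_mul_pos_left ht
    have hgcd : (c * m).gcd (d * m) = m := by
      rw [Nat.gcd_mul_right, hco.gcd_eq_one, one_mul]
    simp only [Nat.mul_div_cancel_left m hdpos, hgcd, Nat.mul_div_cancel _ hm]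
  · intro k h
    have hg : 0 < k.gcd t := Nat.gcd_pos_of_pos_right _ ht
    show k / k.gcd t * (t / (t / k.gcd t)) = k
    rw [Nat.div_div_self (Nat.gcd_dvd_right _ _) ht.ne', Nat.div_mul_cancel (Nat.gcd_dvd_left _ _)]
  · rintro ⟨d, c⟩ h
    simp only [Finset.mem_sigma, Nat.mem_divisors, Finset.mem_Icc, Finset.mem_filter] at h
    obtain ⟨⟨hd, -⟩, -, -⟩ := h
    have hdpos : 0 < d := Nat.pos_of_dvd_of_pos hd ht
    obtain ⟨m, rfl⟩ := hd
    have hm : 0 < m := Nat.pos_of_mul_pos_left ht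
    have hd' : (d : ℝ) ≠ 0 := by exact_mod_cast hdpos.ne'
    have hm' : (m : ℝ) ≠ 0 := by exact_mod_cast hm.ne'
    show H ((c : ℝ) / d) = H (((c * (d * m / d) : ℕ) : ℝ) / ((d * m : ℕ) : ℝ))
    rw [Nat.mul_div_cancel_left m hdpos]
    push_cast
    rw [mul_div_mul_right _ _ hm']

lemma sum_range_mul_eq {M : Type*} [AddCommMonoid M] (g : ℕ → M) (d m : ℕ) :
    ∑ z ∈ Finset.range (d * m), g z =
      ∑ y ∈ Finset.range d, ∑ w ∈ Finset.range m, g (y + d * w) := by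
  rw [Finset.sum_comm]
  induction m with
  | zero => simp
  | succ m ih =>
    rw [Nat.mul_succ, Finset.sum_range_add, ih, Finset.sum_range_succ]
    simp only [add_comm]

/-- Sampled at fractions of denominator `d`, the transform of a period of length `d * m` is that of
the sequence of sums over the progressions of difference `d`. -/
lemma periodTransform_mul_div (f : ℕ → ℂ) {d : ℕ} (hd : 0 < d) (m c : ℕ) :
    periodTransform f (d * m) ((c : ℝ) / d) =
      periodTransform (fun y => ∑ w ∈ Finset.range m, f (y + d * w)) d ((c : ℝ) / d) := by
  have hd' : (d : ℝ) ≠ 0 := by exact_mod_cast hd.ne'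
  rw [periodTransform, sum_range_mul_eq, periodTransform]
  refine Finset.sum_congr rfl fun y _ => ?_
  rw [Finset.sum_mul]
  refine Finset.sum_congr rfl fun w _ => ?_
  have h1 : unitExp (-((c * w : ℕ) : ℝ)) = 1 :=
    (unitExp_eq_one_iff _).2 ⟨-((c * w : ℕ) : ℤ), by push_cast; ring⟩
  have h2 : -((c : ℝ) / d * ((y + d * w : ℕ) : ℝ)) = -(c / d * y) + -((c * w : ℕ) : ℝ) := by
    push_cast
    field_simp
    ring
  rw [h2, unitExp_add, h1, mul_one]

/-- Parseval's identity for the finite Fourier transform. -/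
lemma sum_norm_periodTransform_sq (F : ℕ → ℂ) {d : ℕ} (hd : 0 < d) :
    ∑ c ∈ Finset.Icc 1 d, ‖periodTransform F d ((c : ℝ) / d)‖ ^ 2 =
      d * ∑ y ∈ Finset.range d, ‖F y‖ ^ 2 := by
  have hpt : ∀ x : ℝ, ((‖periodTransform F d x‖ ^ 2 : ℝ) : ℂ) = ∑ y ∈ Finset.range d,
      ∑ z ∈ Finset.range d, F y * (starRingEnd ℂ) (F z) *
        unitExp (x * ((z - y : ℤ) : ℝ)) := by
    intro x
    rw [← Complex.normSq_eq_norm_sq, ← Complex.mul_conj, periodTransform, map_sum,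
      Finset.sum_mul_sum]
    refine Finset.sum_congr rfl fun y _ => Finset.sum_congr rfl fun z _ => ?_
    rw [map_mul, conj_unitExp, neg_neg]
    have : x * ((z - y : ℤ) : ℝ) = -(x * y) + x * z := by push_cast; ring
    rw [this, unitExp_add]
    ring
  have hC : ((∑ c ∈ Finset.Icc 1 d, ‖periodTransform F d ((c : ℝ) / d)‖ ^ 2 : ℝ) : ℂ) =
      ((d * ∑ y ∈ Finset.range d, ‖F y‖ ^ 2 : ℝ) : ℂ) := by
    rw [Complex.ofReal_sum]
    simp only [hpt]
    rw [Finset.sum_comm, Finset.mul_sum, Complex.ofReal_sum]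
    refine Finset.sum_congr rfl fun y hy => ?_
    rw [Finset.sum_comm]
    simp only [← Finset.mul_sum, sum_unitExp_eq hd]
    rw [Finset.sum_eq_single_of_mem y hy]
    · rw [if_pos (by simp), Complex.mul_conj, Complex.normSq_eq_norm_sq]
      push_cast
      ring
    · intro z hz hne
      rw [if_neg, mul_zero]
      intro h
      have h2 : y ≡ z [MOD d] := Nat.modEq_iff_dvd.2 h
      rw [Nat.ModEq, Nat.mod_eq_of_lt (Finset.mem_range.1 hy),
        Nat.mod_eq_of_lt (Finset.mem_range.1 hz)] at h2
      exact hne h2.symm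
  exact_mod_cast hC

/-- A bilinear bound for a `t`-periodic sequence `f` in terms of bounds `B d` for its sums over
arithmetic progressions of difference `d ∣ t`. The Fourier frequencies `k/t` are grouped by their
reduced denominators `d`; Cauchy's inequality is applied to the sum over `d` and, for each `d`, to
the sum over the numerators. -/
lemma norm_sum_mul_periodic_sq_le {f : ℕ → ℂ} {t : ℕ} (ht : 0 < t) (hf : ∀ n, f (n + t) = f n)
    {B : ℕ → ℝ}
    (hB : ∀ d ∈ t.divisors, ∀ y, ‖∑ w ∈ Finset.range (t / d), f (y + d * w)‖ ≤ B d)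
    (δ : ℕ → ℂ) (N : ℕ) :
    ‖∑ n ∈ Finset.Icc 1 N, δ n * f n‖ ^ 2 ≤
      t.divisors.card * ∑ d ∈ t.divisors, ((d : ℝ) / t * B d) ^ 2 * fareySum δ N d := by
  have ht' : (t : ℝ) ≠ 0 := by exact_mod_cast ht.ne'
  have htC : (t : ℂ) ≠ 0 := by exact_mod_cast ht.ne'
  set A : ℕ → ℂ := fun d => ∑ c ∈ (Finset.Icc 1 d).filter (fun c => c.Coprime d),
    periodTransform f t ((c : ℝ) / d) * trigSum δ N ((c : ℝ) / d) with hA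
  have hexp : (t : ℂ) * ∑ n ∈ Finset.Icc 1 N, δ n * f n = ∑ d ∈ t.divisors, A d := by
    rw [hA, ← sum_div_eq_sum_divisors (fun x => periodTransform f t x * trigSum δ N x) ht]
    simp only [trigSum, Finset.mul_sum]
    rw [Finset.sum_comm]
    refine Finset.sum_congr rfl fun n _ => ?_
    rw [mul_left_comm, ← sum_periodTransform_mul ht hf n, Finset.mul_sum]
    exact Finset.sum_congr rfl fun k _ => by ring
  have hAd : ∀ d ∈ t.divisors, ‖A d‖ ^ 2 ≤ (d * B d) ^ 2 * fareySum δ N d := by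
    intro d hd
    obtain ⟨hdt, -⟩ := Nat.mem_divisors.1 hd
    have hdpos : 0 < d := Nat.pos_of_dvd_of_pos hdt ht
    have hG : ∑ c ∈ (Finset.Icc 1 d).filter (fun c => c.Coprime d),
        ‖periodTransform f t ((c : ℝ) / d)‖ ^ 2 ≤ (d * B d) ^ 2 := by
      calc ∑ c ∈ (Finset.Icc 1 d).filter (fun c => c.Coprime d),
            ‖periodTransform f t ((c : ℝ) / d)‖ ^ 2
          ≤ ∑ c ∈ Finset.Icc 1 d, ‖periodTransform f t ((c : ℝ) / d)‖ ^ 2 :=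
            Finset.sum_le_sum_of_subset_of_nonneg (Finset.filter_subset _ _)
              fun _ _ _ => by positivity
        _ = d * ∑ y ∈ Finset.range d, ‖∑ w ∈ Finset.range (t / d), f (y + d * w)‖ ^ 2 := by
            rw [← sum_norm_periodTransform_sq _ hdpos]
            refine Finset.sum_congr rfl fun c _ => ?_
            rw [← periodTransform_mul_div f hdpos, Nat.mul_div_cancel' hdt]
        _ ≤ d * ∑ y ∈ Finset.range d, B d ^ 2 := by
            gcongr with y _
            exact hB d hd y
        _ = (d * B d) ^ 2 := by
            rw [Finset.sum_const, Finset.card_range, nsmul_eq_mul]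
            ring
    calc ‖A d‖ ^ 2
        ≤ (∑ c ∈ (Finset.Icc 1 d).filter (fun c => c.Coprime d),
            ‖periodTransform f t ((c : ℝ) / d)‖ * ‖trigSum δ N ((c : ℝ) / d)‖) ^ 2 := by
          gcongr
          refine (norm_sum_le _ _).trans (Finset.sum_le_sum fun c _ => (norm_mul _ _).le)
      _ ≤ _ := Finset.sum_mul_sq_le_sq_mul_sq _ _ _
      _ ≤ (d * B d) ^ 2 * fareySum δ N d := by
          gcongr
          exact le_rfl
  have hcs : ‖(t : ℂ) * ∑ n ∈ Finset.Icc 1 N, δ n * f n‖ ^ 2 ≤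
      t.divisors.card * ∑ d ∈ t.divisors, (d * B d) ^ 2 * fareySum δ N d := by
    rw [hexp]
    calc ‖∑ d ∈ t.divisors, A d‖ ^ 2 ≤ (∑ d ∈ t.divisors, ‖A d‖) ^ 2 := by
          gcongr
          exact norm_sum_le _ _
      _ ≤ t.divisors.card * ∑ d ∈ t.divisors, ‖A d‖ ^ 2 := sq_sum_le_card_mul_sum_sq
      _ ≤ _ := by
          gcongr with d hd
          exact hAd d hd
  rw [norm_mul, Complex.norm_natCast, mul_pow, mul_comm, ← le_div_iff₀ (by positivity)] at hcs
  refine hcs.trans (le_of_eq ?_)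
  rw [mul_div_assoc, Finset.sum_div]
  congr 1
  refine Finset.sum_congr rfl fun d _ => ?_
  field_simp

/-! ### Exponential sums over the powers of `λ` modulo a prime -/

lemma expMod_eq_unitExp (m : ℕ) (z : ℤ) : expMod m z = unitExp ((z : ℝ) / m) := by
  rw [expMod, unitExp]
  congr 1
  push_cast
  ring

lemma norm_expMod (m : ℕ) (z : ℤ) : ‖expMod m z‖ = 1 := by
  rw [expMod_eq_unitExp, norm_unitExp]

lemma expMod_congr {m : ℕ} (hm : 0 < m) {z z' : ℤ} (h : (z : ZMod m) = z') :
    expMod m z = expMod m z' := by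
  obtain ⟨k, hk⟩ := (ZMod.intCast_eq_intCast_iff_dvd_sub z z' m).1 h
  have hm' : (m : ℝ) ≠ 0 := by exact_mod_cast hm.ne'
  have h1 : (z' : ℝ) / m = z / m + k := by
    have : (z' : ℝ) - z = m * k := by exact_mod_cast hk
    field_simp
    linarith
  rw [expMod_eq_unitExp, expMod_eq_unitExp, h1, unitExp_add, (unitExp_eq_one_iff _).2 ⟨k, rfl⟩,
    mul_one]

lemma natCast_zmod_ne_zero {p lam : ℕ} (hlam : ¬ p ∣ lam) : (lam : ZMod p) ≠ 0 := fun h =>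
  hlam ((ZMod.natCast_eq_zero_iff lam p).1 h)

lemma orderOf_natCast_dvd_sub_one {p lam : ℕ} (hp : p.Prime) (hlam : ¬ p ∣ lam) :
    orderOf (lam : ZMod p) ∣ p - 1 := by
  have : Fact p.Prime := ⟨hp⟩
  exact ZMod.orderOf_dvd_card_sub_one (natCast_zmod_ne_zero hlam)

lemma orderOf_natCast_pos {p lam : ℕ} (hp : p.Prime) (hlam : ¬ p ∣ lam) :
    0 < orderOf (lam : ZMod p) :=
  Nat.pos_of_dvd_of_pos (orderOf_natCast_dvd_sub_one hp hlam) (Nat.sub_pos_of_lt hp.one_lt)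

/-- The sums along progressions of difference `d` are complete exponential sums over the powers of
`λ ^ d`, an element of order `t / d`. -/
lemma norm_sum_progression_le {p lam : ℕ} (hp : p.Prime) (hlam : ¬ p ∣ lam) {B : ℝ} {d : ℕ}
    (hd : d ∣ orderOf (lam : ZMod p))
    (hB : ∀ θ : ℤ, IsCoprime θ (p : ℤ) → orderOf (θ : ZMod p) = orderOf (lam : ZMod p) / d →
      ∀ a : ℤ, IsCoprime a (p : ℤ) →
        ‖∑ z ∈ Finset.Icc 1 (orderOf (θ : ZMod p)), expMod p (a * θ ^ z)‖ ≤ B)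
    {a : ℤ} (ha : IsCoprime a (p : ℤ)) (y : ℕ) :
    ‖∑ w ∈ Finset.range (orderOf (lam : ZMod p) / d),
      expMod p (a * (lam : ℤ) ^ (y + d * w))‖ ≤ B := by
  have ht := orderOf_natCast_pos hp hlam
  set t := orderOf (lam : ZMod p) with htdef
  have hlamc : IsCoprime (lam : ℤ) (p : ℤ) :=
    Nat.isCoprime_iff_coprime.2 ((hp.coprime_iff_not_dvd.2 hlam).symm)
  have hord : orderOf (((lam : ℤ) ^ d : ℤ) : ZMod p) = t / d := by
    push_cast
    exact orderOf_pow_of_dvd (Nat.pos_of_dvd_of_pos hd ht).ne' hd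
  have key := hB ((lam : ℤ) ^ d) hlamc.pow_left hord (a * (lam : ℤ) ^ y)
    (ha.mul_left hlamc.pow_left)
  rw [hord] at key
  convert key using 2
  have h1 : ∀ w : ℕ, a * (lam : ℤ) ^ (y + d * w) =
      a * (lam : ℤ) ^ y * ((lam : ℤ) ^ d) ^ w := fun w => by ring
  simp only [h1]
  -- The terms with `w = 0` and `w = t / d` agree.
  have h2 : expMod p (a * (lam : ℤ) ^ y * ((lam : ℤ) ^ d) ^ (t / d)) =
      expMod p (a * (lam : ℤ) ^ y * ((lam : ℤ) ^ d) ^ 0) := by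
    apply expMod_congr hp.pos
    rw [← pow_mul, Nat.mul_div_cancel' hd]
    push_cast
    rw [htdef, pow_orderOf_eq_one, pow_zero]
  have h3 := Finset.sum_range_succ
    (fun w => expMod p (a * (lam : ℤ) ^ y * ((lam : ℤ) ^ d) ^ w)) (t / d)
  rw [Finset.sum_range_succ', ← h2, add_left_inj] at h3
  rw [← h3, ← Finset.Ico_add_one_right_eq_Icc, Finset.sum_Ico_eq_sum_range, add_tsub_cancel_right]
  simp only [add_comm]

/-- The weighted bound for a single prime. For large `d` the trivial bound for the sums along
progressions of difference `d` is used, for small `d` the bound `K p ^ α (t / d) ^ β`. -/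
lemma maxSqExpSum_le {α β K X Δ D : ℝ} (hα : 0 ≤ α) (hβ : β ≤ 1) (hΔ : 0 < Δ)
    {p lam : ℕ} (hp : p.Prime) (hlam : ¬ p ∣ lam) (hpX : (p : ℝ) ≤ X)
    (hord : Δ < (orderOf (lam : ZMod p) : ℝ))
    (hK : ∀ θ : ℤ, IsCoprime θ (p : ℤ) → ∀ a : ℤ, IsCoprime a (p : ℤ) →
        ‖∑ z ∈ Finset.Icc 1 (orderOf (θ : ZMod p)), expMod p (a * θ ^ z)‖ ≤
          K * (p : ℝ) ^ α * (orderOf (θ : ZMod p) : ℝ) ^ β)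
    (N : ℕ) (δ : ℕ → ℂ) :
    (1 / ((p - 1).divisors.card : ℝ)) * maxSqExpSum lam p N δ ≤
      ∑ d ∈ (p - 1).divisors, (if D ≤ d then 1 else K ^ 2 * X ^ (2 * α) * (Δ / d) ^ (2 * β - 2)) *
        fareySum δ N d := by
  have ht := orderOf_natCast_pos hp hlam
  have htp := orderOf_natCast_dvd_sub_one hp hlam
  set t := orderOf (lam : ZMod p) with htdef
  have hp1 : p - 1 ≠ 0 := (Nat.sub_pos_of_lt hp.one_lt).ne'
  have hp0 : (0 : ℝ) < p := by exact_mod_cast hp.pos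
  have hX : 0 < X := hp0.trans_le hpX
  set W : ℕ → ℝ := fun d => if D ≤ d then 1 else K ^ 2 * X ^ (2 * α) * (Δ / d) ^ (2 * β - 2)
    with hW
  have hW0 : ∀ d, 0 ≤ W d := by
    intro d
    simp only [hW]
    split_ifs
    · exact zero_le_one
    · positivity
  set B : ℕ → ℝ := fun d => if D ≤ d then ((t / d : ℕ) : ℝ) else
    K * (p : ℝ) ^ α * ((t / d : ℕ) : ℝ) ^ β with hB
  have hBW : ∀ d ∈ t.divisors, ((d : ℝ) / t * B d) ^ 2 ≤ W d := by
    intro d hd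
    obtain ⟨hdt, -⟩ := Nat.mem_divisors.1 hd
    have hdpos : (0 : ℝ) < d := by exact_mod_cast Nat.pos_of_dvd_of_pos hdt ht
    have htpos : (0 : ℝ) < t := by exact_mod_cast ht
    have hcast : ((t / d : ℕ) : ℝ) = (t : ℝ) / d := Nat.cast_div hdt hdpos.ne'
    simp only [hB, hW, hcast]
    split_ifs
    · have : (d : ℝ) / t * (t / d) = 1 := by field_simp
      rw [this, one_pow]
    · have hu : (0 : ℝ) < t / d := by positivity
      have h1 : (d : ℝ) / t * (K * (p : ℝ) ^ α * ((t : ℝ) / d) ^ β) =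
          K * (p : ℝ) ^ α * ((t : ℝ) / d) ^ (β - 1) := by
        rw [Real.rpow_sub_one hu.ne']
        field_simp
      have h2 : (((t : ℝ) / d) ^ (β - 1)) ^ 2 = ((t : ℝ) / d) ^ (2 * β - 2) := by
        rw [← Real.rpow_natCast, ← Real.rpow_mul hu.le]
        congr 1
        push_cast
        ring
      have h3 : ((p : ℝ) ^ α) ^ 2 = (p : ℝ) ^ (2 * α) := by
        rw [← Real.rpow_natCast, ← Real.rpow_mul hp0.le]
        congr 1
        push_cast
        ring
      rw [h1, mul_pow, mul_pow, h2, h3]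
      have h4 : ((t : ℝ) / d) ^ (2 * β - 2) ≤ (Δ / d) ^ (2 * β - 2) :=
        Real.rpow_le_rpow_of_nonpos (by positivity) (by gcongr) (by linarith)
      gcongr
  have hmax : maxSqExpSum lam p N δ ≤
      (p - 1).divisors.card * ∑ d ∈ (p - 1).divisors, W d * fareySum δ N d := by
    have : Nonempty {a : ℤ // IsCoprime a (p : ℤ)} := ⟨⟨1, isCoprime_one_left⟩⟩
    refine ciSup_le fun a => ?_
    have hper : ∀ n : ℕ, expMod p (a.1 * (lam : ℤ) ^ (n + t)) = expMod p (a.1 * (lam : ℤ) ^ n) := by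
      intro n
      apply expMod_congr hp.pos
      push_cast
      rw [pow_add, htdef, pow_orderOf_eq_one, mul_one]
    have hBsum : ∀ d ∈ t.divisors, ∀ y : ℕ,
        ‖∑ w ∈ Finset.range (t / d), expMod p (a.1 * (lam : ℤ) ^ (y + d * w))‖ ≤ B d := by
      intro d hd y
      refine norm_sum_progression_le hp hlam (Nat.dvd_of_mem_divisors hd) ?_ a.2 y
      intro θ hθ hθo b hb
      simp only [hB]
      split_ifs
      · refine (norm_sum_le _ _).trans ?_
        simp only [norm_expMod]
        rw [Finset.sum_const, Nat.card_Icc, add_tsub_cancel_right, hθo, nsmul_eq_mul, mul_one]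
      · rw [htdef, ← hθo]
        exact hK θ hθ b hb
    refine (norm_sum_mul_periodic_sq_le ht hper hBsum δ N).trans ?_
    have hsub : t.divisors ⊆ (p - 1).divisors := Nat.divisors_subset_of_dvd hp1 htp
    have hle : ∑ d ∈ t.divisors, ((d : ℝ) / t * B d) ^ 2 * fareySum δ N d ≤
        ∑ d ∈ (p - 1).divisors, W d * fareySum δ N d := by
      calc _ ≤ ∑ d ∈ t.divisors, W d * fareySum δ N d :=
            Finset.sum_le_sum fun d hd =>
              mul_le_mul_of_nonneg_right (hBW d hd) (fareySum_nonneg δ N d)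
        _ ≤ _ := Finset.sum_le_sum_of_subset_of_nonneg hsub
            fun d _ _ => mul_nonneg (hW0 d) (fareySum_nonneg δ N d)
    have hsum0 : 0 ≤ ∑ d ∈ (p - 1).divisors, W d * fareySum δ N d :=
      Finset.sum_nonneg fun d _ => mul_nonneg (hW0 d) (fareySum_nonneg δ N d)
    have hcard : (t.divisors.card : ℝ) ≤ (p - 1).divisors.card := by
      exact_mod_cast Finset.card_le_card hsub
    exact (mul_le_mul_of_nonneg_left hle (Nat.cast_nonneg _)).trans
      (mul_le_mul_of_nonneg_right hcard hsum0)
  have hcard0 : (0 : ℝ) < (p - 1).divisors.card := by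
    exact_mod_cast Finset.card_pos.2 (Nat.nonempty_divisors.2 hp1)
  rw [one_div, inv_mul_le_iff₀ hcard0]
  exact hmax

/-! ### Summation over the primes -/

lemma sum_divisors_sub_one_le {h : ℕ → ℝ} (hh : ∀ d, 0 ≤ h d) {X : ℝ} (hX : 0 ≤ X)
    {s : Finset ℕ} (hs : s ⊆ Finset.Icc 2 ⌊X⌋₊) :
    ∑ p ∈ s, ∑ d ∈ (p - 1).divisors, h d ≤ X * ∑ d ∈ Finset.Icc 1 ⌊X⌋₊, h d / d := by
  have h1 : ∀ p ∈ s, ∑ d ∈ (p - 1).divisors, h d =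
      ∑ d ∈ Finset.Icc 1 ⌊X⌋₊, if d ∣ p - 1 then h d else 0 := by
    intro p hp
    obtain ⟨hp2, hpX⟩ := Finset.mem_Icc.1 (hs hp)
    rw [← Finset.sum_filter]
    refine Finset.sum_congr ?_ fun _ _ => rfl
    ext d
    simp only [Nat.mem_divisors, Finset.mem_filter, Finset.mem_Icc]
    constructor
    · rintro ⟨hd, h0⟩
      exact ⟨⟨Nat.pos_of_dvd_of_pos hd (by omega),
        (Nat.le_of_dvd (by omega) hd).trans (by omega)⟩, hd⟩
    · rintro ⟨-, hd⟩
      exact ⟨hd, by omega⟩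
  rw [Finset.sum_congr rfl h1, Finset.sum_comm, Finset.mul_sum]
  refine Finset.sum_le_sum fun d hd => ?_
  have hd0 : (0 : ℝ) < d := by exact_mod_cast (Finset.mem_Icc.1 hd).1
  have hcard : (s.filter fun p => d ∣ p - 1).card ≤ ⌊X⌋₊ / d := by
    rw [← Nat.Ioc_filter_dvd_card_eq_div]
    refine Finset.card_le_card_of_injOn (fun p => p - 1) ?_ ?_
    · intro p hp
      obtain ⟨hps, hdp⟩ := Finset.mem_filter.1 hp
      obtain ⟨hp2, hpX⟩ := Finset.mem_Icc.1 (hs hps)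
      have h2 : 0 < p - 1 ∧ p - 1 ≤ ⌊X⌋₊ := by omega
      exact Finset.mem_filter.2 ⟨Finset.mem_Ioc.2 h2, hdp⟩
    · intro p hp p' hp' heq
      have h2 := (Finset.mem_Icc.1 (hs (Finset.mem_filter.1 hp).1)).1
      have h2' := (Finset.mem_Icc.1 (hs (Finset.mem_filter.1 hp').1)).1
      simp only at heq
      omega
  have hcard' : ((s.filter fun p => d ∣ p - 1).card : ℝ) ≤ X / d :=
    calc ((s.filter fun p => d ∣ p - 1).card : ℝ) ≤ ((⌊X⌋₊ / d : ℕ) : ℝ) := by exact_mod_cast hcard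
      _ ≤ (⌊X⌋₊ : ℝ) / d := Nat.cast_div_le
      _ ≤ X / d := by
        gcongr
        exact Nat.floor_le hX
  rw [← Finset.sum_filter, Finset.sum_const, nsmul_eq_mul]
  calc _ ≤ X / d * h d := mul_le_mul_of_nonneg_right hcard' (hh d)
    _ = X * (h d / d) := by ring

/-- The contribution of the denominators `d ≥ D = 1 / R`, from the large sieve inequality. -/
lemma sum_large_denominators_le (δ : ℕ → ℂ) (N : ℕ) {X R : ℝ} (hX : 0 ≤ X) (hR : 0 < R) :
    ∑ d ∈ (Finset.Icc 1 ⌊X⌋₊).filter (fun d : ℕ => R⁻¹ ≤ d), fareySum δ N d / d ≤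
      (2 * X + (1 + 4 * Real.pi ^ 2) * N * R) * ∑ n ∈ Finset.Icc 1 N, ‖δ n‖ ^ 2 := by
  have hE0 : 0 ≤ ∑ n ∈ Finset.Icc 1 N, ‖δ n‖ ^ 2 := Finset.sum_nonneg fun _ _ => by positivity
  set q := max 1 ⌈R⁻¹⌉₊ with hq
  have hq1 : 1 ≤ q := le_max_left _ _
  have hqR : R⁻¹ ≤ q := (Nat.le_ceil _).trans (by exact_mod_cast le_max_right _ _)
  have hsub : (Finset.Icc 1 ⌊X⌋₊).filter (fun d : ℕ => R⁻¹ ≤ d) ⊆ Finset.Icc q ⌊X⌋₊ := by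
    intro d hd
    simp only [Finset.mem_filter, Finset.mem_Icc] at hd ⊢
    exact ⟨max_le hd.1.1 (Nat.ceil_le.2 hd.2), hd.1.2⟩
  refine (Finset.sum_le_sum_of_subset_of_nonneg hsub fun d _ _ =>
    div_nonneg (fareySum_nonneg δ N d) d.cast_nonneg).trans ?_
  rcases le_or_gt q ⌊X⌋₊ with h | h
  · refine (sum_fareySum_div_le δ N hq1 h).trans ?_
    have h1 : (⌊X⌋₊ : ℝ) ≤ X := Nat.floor_le hX
    have hq0 : (0 : ℝ) < q := by exact_mod_cast hq1
    have h2 : (q : ℝ)⁻¹ ≤ R := inv_le_of_inv_le₀ hR hqR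
    rw [div_eq_mul_inv]
    gcongr
  · rw [Finset.Icc_eq_empty_of_lt h, Finset.sum_empty]
    exact mul_nonneg (by positivity) hE0

/-- The contribution of the denominators `d < D = 1 / R`, from the trivial bound for `S(c/d)`. -/
lemma sum_small_denominators_le (δ : ℕ → ℂ) (N M : ℕ) {β Δ R : ℝ} (hβ : β ≤ 1) (hΔ : 0 < Δ)
    (hR : 0 < R) :
    ∑ d ∈ (Finset.Icc 1 M).filter (fun d : ℕ => ¬ R⁻¹ ≤ d),
        (Δ / d) ^ (2 * β - 2) * fareySum δ N d / d ≤
      Δ ^ (2 * β - 2) * R ^ (2 * β - 3) * (∑ n ∈ Finset.Icc 1 N, ‖δ n‖) ^ 2 := by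
  set S := (∑ n ∈ Finset.Icc 1 N, ‖δ n‖) ^ 2 with hS
  have hS0 : 0 ≤ S := sq_nonneg _
  have hterm : ∀ d ∈ (Finset.Icc 1 M).filter (fun d : ℕ => ¬ R⁻¹ ≤ d),
      (Δ / d) ^ (2 * β - 2) * fareySum δ N d / d ≤ (Δ * R) ^ (2 * β - 2) * S := by
    intro d hd
    simp only [Finset.mem_filter, Finset.mem_Icc, not_le] at hd
    have hd0 : (0 : ℝ) < d := by exact_mod_cast hd.1.1
    have h1 : (Δ / d) ^ (2 * β - 2) ≤ (Δ * R) ^ (2 * β - 2) := by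
      refine Real.rpow_le_rpow_of_nonpos (by positivity) ?_ (by linarith)
      rw [div_eq_mul_inv]
      have : R ≤ (d : ℝ)⁻¹ := (le_inv_comm₀ hR hd0).2 hd.2.le
      gcongr
    have h2 : fareySum δ N d / d ≤ S := by
      rw [div_le_iff₀ hd0, mul_comm]
      exact fareySum_le δ N d
    rw [mul_div_assoc]
    have h3 : 0 ≤ fareySum δ N d / d := div_nonneg (fareySum_nonneg δ N d) hd0.le
    gcongr
  have hcard : (((Finset.Icc 1 M).filter (fun d : ℕ => ¬ R⁻¹ ≤ d)).card : ℝ) ≤ R⁻¹ := by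
    have hsub : (Finset.Icc 1 M).filter (fun d : ℕ => ¬ R⁻¹ ≤ d) ⊆ Finset.Icc 1 ⌊R⁻¹⌋₊ := by
      intro d hd
      simp only [Finset.mem_filter, Finset.mem_Icc, not_le] at hd ⊢
      exact ⟨hd.1.1, Nat.le_floor hd.2.le⟩
    have h1 := Finset.card_le_card hsub
    rw [Nat.card_Icc, add_tsub_cancel_right] at h1
    exact (Nat.cast_le.2 h1).trans (Nat.floor_le (inv_nonneg.2 hR.le))
  refine (Finset.sum_le_card_nsmul _ _ _ hterm).trans ?_
  rw [nsmul_eq_mul]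
  have h1 : R ^ (2 * β - 3) = R ^ (2 * β - 2) * R⁻¹ := by
    rw [← div_eq_mul_inv, ← Real.rpow_sub_one hR.ne']
    congr 1
    ring
  calc _ ≤ R⁻¹ * ((Δ * R) ^ (2 * β - 2) * S) := by gcongr
    _ = _ := by
      rw [Real.mul_rpow hΔ.le hR.le, h1]
      ring

theorem theorem6 (α β : ℝ) (hαβ : (α, β) ∈ admissiblePairs) :
    ∃ C : ℝ, ∀ lam : ℕ, 2 ≤ lam → ∀ X Δ : ℝ, 0 < X → X ^ (1 / 3 : ℝ) < Δ →
      ∀ N : ℕ, 0 < N → ∀ L : ℝ, 0 < L → ∀ δ : ℕ → ℂ,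
        ∑ p ∈ largeOrderPrimes lam Δ X,
            (1 / ((p - 1).divisors.card : ℝ)) * maxSqExpSum lam p N δ ≤
          C * (X * (X + (N : ℝ) * X ^ (2 * α / (3 - 2 * β)) *
                  Δ ^ (-((2 - 2 * β) / (3 - 2 * β))) * L) *
                ∑ n ∈ Finset.Icc 1 N, ‖δ n‖ ^ 2
              + X * L ^ (-3 + 2 * β) * (∑ n ∈ Finset.Icc 1 N, ‖δ n‖) ^ 2) := by
  obtain ⟨⟨hα, -⟩, ⟨-, hβ⟩, K, hK⟩ := hαβ
  simp only at hα hβ hK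
  refine ⟨2 + (1 + 4 * Real.pi ^ 2) + K ^ 2, ?_⟩
  intro lam _ X Δ hX hXΔ N _ L hL δ
  have hΔ : 0 < Δ := (Real.rpow_pos_of_pos hX _).trans hXΔ
  have h32 : 3 - 2 * β ≠ 0 := by linarith
  set E := ∑ n ∈ Finset.Icc 1 N, ‖δ n‖ ^ 2 with hE
  set S := (∑ n ∈ Finset.Icc 1 N, ‖δ n‖) ^ 2 with hS
  have hE0 : 0 ≤ E := Finset.sum_nonneg fun _ _ => by positivity
  have hS0 : 0 ≤ S := sq_nonneg _
  -- The denominators are split at `1 / R`, where both contributions have the stated shape.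
  set R := X ^ (2 * α / (3 - 2 * β)) * Δ ^ (-((2 - 2 * β) / (3 - 2 * β))) * L with hR
  have hR0 : 0 < R := by positivity
  have hRpow : X ^ (2 * α) * (Δ ^ (2 * β - 2) * R ^ (2 * β - 3)) = L ^ (-3 + 2 * β) := by
    have e1 : 2 * α / (3 - 2 * β) * (2 * β - 3) = -(2 * α) := by field_simp; ring
    have e2 : -((2 - 2 * β) / (3 - 2 * β)) * (2 * β - 3) = -(2 * β - 2) := by field_simp; ring
    have e3 : -3 + 2 * β = 2 * β - 3 := by ring
    rw [hR, Real.mul_rpow (by positivity) hL.le, Real.mul_rpow (by positivity) (by positivity),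
      ← Real.rpow_mul hX.le, ← Real.rpow_mul hΔ.le, e1, e2, e3, Real.rpow_neg hX.le,
      Real.rpow_neg hΔ.le]
    have h1 : X ^ (2 * α) ≠ 0 := by positivity
    have h2 : Δ ^ (2 * β - 2) ≠ 0 := by positivity
    field_simp
  set W : ℕ → ℝ := fun d => if R⁻¹ ≤ d then 1 else K ^ 2 * X ^ (2 * α) * (Δ / d) ^ (2 * β - 2)
    with hW
  have hW0 : ∀ d, 0 ≤ W d := by
    intro d
    simp only [hW]
    split_ifs
    · exact zero_le_one
    · positivity
  have hsub : largeOrderPrimes lam Δ X ⊆ Finset.Icc 2 ⌊X⌋₊ := by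
    intro p hp
    obtain ⟨h1, h2, -⟩ := Finset.mem_filter.1 hp
    exact Finset.mem_Icc.2 ⟨h2.two_le, (Finset.mem_Icc.1 h1).2⟩
  have hstep : ∑ p ∈ largeOrderPrimes lam Δ X,
      (1 / ((p - 1).divisors.card : ℝ)) * maxSqExpSum lam p N δ ≤
        X * ∑ d ∈ Finset.Icc 1 ⌊X⌋₊, W d * fareySum δ N d / d := by
    refine (Finset.sum_le_sum fun p hp => ?_).trans (sum_divisors_sub_one_le
      (fun d => mul_nonneg (hW0 d) (fareySum_nonneg δ N d)) hX.le hsub)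
    obtain ⟨h1, h2, h3, h4⟩ := Finset.mem_filter.1 hp
    exact maxSqExpSum_le hα hβ hΔ h2 h3
      ((Nat.le_floor_iff hX.le).1 (Finset.mem_Icc.1 h1).2) h4 (hK p h2) N δ
  have hlarge := sum_large_denominators_le δ N hX.le hR0
  have hsmall := sum_small_denominators_le δ N ⌊X⌋₊ hβ hΔ hR0
  have hsplit : ∑ d ∈ Finset.Icc 1 ⌊X⌋₊, W d * fareySum δ N d / d =
      ∑ d ∈ (Finset.Icc 1 ⌊X⌋₊).filter (fun d : ℕ => R⁻¹ ≤ d), fareySum δ N d / d +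
      K ^ 2 * X ^ (2 * α) * ∑ d ∈ (Finset.Icc 1 ⌊X⌋₊).filter (fun d : ℕ => ¬ R⁻¹ ≤ d),
        (Δ / d) ^ (2 * β - 2) * fareySum δ N d / d := by
    rw [← Finset.sum_filter_add_sum_filter_not _ (fun d : ℕ => R⁻¹ ≤ d), Finset.mul_sum]
    congr 1
    · refine Finset.sum_congr rfl fun d hd => ?_
      simp only [hW, if_pos (Finset.mem_filter.1 hd).2, one_mul]
    · refine Finset.sum_congr rfl fun d hd => ?_
      simp only [hW, if_neg (Finset.mem_filter.1 hd).2]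
      ring
  rw [hsplit] at hstep
  have hbound : X * (∑ d ∈ (Finset.Icc 1 ⌊X⌋₊).filter (fun d : ℕ => R⁻¹ ≤ d), fareySum δ N d / d +
      K ^ 2 * X ^ (2 * α) * ∑ d ∈ (Finset.Icc 1 ⌊X⌋₊).filter (fun d : ℕ => ¬ R⁻¹ ≤ d),
        (Δ / d) ^ (2 * β - 2) * fareySum δ N d / d) ≤
      X * ((2 * X + (1 + 4 * Real.pi ^ 2) * N * R) * E + K ^ 2 * X ^ (2 * α) *
        (Δ ^ (2 * β - 2) * R ^ (2 * β - 3) * S)) := by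
    gcongr
  have hfin : X * ((2 * X + (1 + 4 * Real.pi ^ 2) * N * R) * E + K ^ 2 * X ^ (2 * α) *
        (Δ ^ (2 * β - 2) * R ^ (2 * β - 3) * S)) =
      2 * (X * X * E) + (1 + 4 * Real.pi ^ 2) * (X * (N * R) * E) +
        K ^ 2 * (X * L ^ (-3 + 2 * β) * S) := by
    rw [← hRpow]
    ring
  have hNR : (N : ℝ) * X ^ (2 * α / (3 - 2 * β)) * Δ ^ (-((2 - 2 * β) / (3 - 2 * β))) * L =
      N * R := by
    rw [hR]
    ring
  rw [hNR]
  have p1 : 0 ≤ X * X * E := by positivity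
  have p2 : 0 ≤ X * (N * R) * E := by positivity
  have p3 : 0 ≤ X * L ^ (-3 + 2 * β) * S := by positivity
  have hexpand : (2 + (1 + 4 * Real.pi ^ 2) + K ^ 2) *
      (X * (X + N * R) * E + X * L ^ (-3 + 2 * β) * S) =
      (2 * (X * X * E) + (1 + 4 * Real.pi ^ 2) * (X * (N * R) * E) +
        K ^ 2 * (X * L ^ (-3 + 2 * β) * S)) +
      (1 + 4 * Real.pi ^ 2 + K ^ 2) * (X * X * E) + (2 + K ^ 2) * (X * (N * R) * E) +
        (2 + (1 + 4 * Real.pi ^ 2)) * (X * L ^ (-3 + 2 * β) * S) := by ring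
  rw [hexpand]
  have q1 : 0 ≤ (1 + 4 * Real.pi ^ 2 + K ^ 2) * (X * X * E) := by positivity
  have q2 : 0 ≤ (2 + K ^ 2) * (X * (N * R) * E) := by positivity
  have q3 : 0 ≤ (2 + (1 + 4 * Real.pi ^ 2)) * (X * L ^ (-3 + 2 * β) * S) := by positivity
  linarith
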